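/- Let $N\ge 2$, let $2\le D\le K-1$, and let $\mathbb F_q$ be any finite field. $K$ independent messages $X_1,\dots,X_K$, each uniform on $\mathbb F_q^L$ for some $L\ge 1$, are replicated on $N$ servers. A user demands $X_W=(X_i)_{i\in W}$, where the random set $W$ is independent of the messages and takes each of the values $W_j=\{j,\dots,j+D-1\}$, $1\le j\le K-D+1$, with positive probability. In a balanced $\{0,1\}$-linear scheme the user draws queries $Q_1,\dots,Q_N$, with a joint law that depends on $W$ only and, given $W$, independently of the messages. Each $Q_n$ specifies the same number $T$ of linear combinations, with coefficients in $\{0,1\}$, of the $KL$ message symbols, and server $n$ returns the corresponding $T$ values $A_n\in\mathbb F_q^T$. The scheme has to be correct, $H(X_{W_j}\mid Q_{1},\dots,Q_N,A_{1},\dots,A_N)=0$ under the law given $W=W_j$, for every $j$, and private, $I(W;Q_n,A_n,X_1,\dots,X_K)=0$ for every $n$. Its retrieval rate is $H(X_W)/\sum_{n=1}^N H(A_n\mid Q_n)$ (entropies in base $q$). Then the maximum retrieval rate over all such schemes, with $L\ge1$ and $T$ arbitrary, exists and equals $$R=\frac{D N^{f}}{D N\,\dfrac{N^{f}-1}{N-1}+K-Df},\qquad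 f=\left\lfloor \frac KD\right\rfloor .$$ The same holds when the rate is counted in symbols, as $DL/(NT)$, the number of desired symbols divided by the number of retrieved symbols: the maximum is again $R$. -/

import Mathlib

noncomputable section

namespace PCBR

/-- Shannon entropy, in base `b`, of the random variable `Y` with finitely many values, defined on
a discrete probability space with law `μ`. -/
def entropy {Ω α : Type*} [Fintype α] (b : ℝ) (μ : PMF Ω) (Y : Ω → α) : ℝ :=
  ∑ y : α, Real.negMulLog ((μ.map Y) y).toReal / Real.log b

/-- Conditional entropy `H(Y | Z) = H(Y, Z) - H(Z)`. -/
def condEntropy {Ω α β : Type*} [Fintype α] [Fintype β] (b : ℝ) (μ : PMF Ω)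
    (Y : Ω → α) (Z : Ω → β) : ℝ :=
  entropy b μ (fun ω => (Y ω, Z ω)) - entropy b μ Z

/-- Mutual information `I(Y ; Z) = H(Y) + H(Z) - H(Y, Z)`. -/
def mutualInfo {Ω α β : Type*} [Fintype α] [Fintype β] (b : ℝ) (μ : PMF Ω)
    (Y : Ω → α) (Z : Ω → β) : ℝ :=
  entropy b μ Y + entropy b μ Z - entropy b μ (fun ω => (Y ω, Z ω))

/-- A dataset: `K` messages, each consisting of `L` subpackets, each a single symbol of `F`. -/
abbrev Dataset (F : Type*) (K L : ℕ) : Type _ := Fin K → Fin L → F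

/-- A query to one server: `T` linear combinations of the `K * L` subpackets, each given by its
coefficients in `{0, 1}` (`true` stands for `1`, `false` for `0`). -/
abbrev Query (K L T : ℕ) : Type := Fin T → Fin K → Fin L → Bool

/-- The answer of a server to a query: the `T` requested linear combinations over `F`. -/
def answer {F : Type*} [Field F] {K L T : ℕ} (Q : Query K L T) (X : Dataset F K L) : Fin T → F :=
  fun t => ∑ i : Fin K, ∑ l : Fin L, (if Q t i l then (1 : F) else 0) * X i l

/-- Messages and candidate demands are numbered from `0`. The candidate demand index set with
number `j` is the interval `{j, …, j + D - 1}`; this is its `d`-th element. -/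
def demandIndex {K D : ℕ} (h : D ≤ K) (j : Fin (K - D + 1)) (d : Fin D) : Fin K :=
  ⟨j.1 + d.1, by have := j.2; have := d.2; omega⟩

/-- The demand messages `X_W` for the demand `W = {j, …, j + D - 1}`. -/
def demandMessages {F : Type*} {K D L : ℕ} (h : D ≤ K) (j : Fin (K - D + 1))
    (X : Dataset F K L) : Fin D → Fin L → F :=
  fun d => X (demandIndex h j d)

/-- A balanced `{0,1}`-linear scheme with `N` servers, `K` messages, `D` demand messages and
subpacketization level `L`: for each candidate demand, a (jointly distributed, possibly random)
choice of one query per server. Every server is asked for the same number `T` of linear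
combinations, so that all queries have the same length, and all answers too. -/
structure Scheme (N K D L T : ℕ) where
  /-- the law of the `N` queries for a given demand -/
  queryLaw : Fin (K - D + 1) → PMF (Fin N → Query K L T)

namespace Scheme

/-- The joint law of queries and dataset for the demand number `j`: the dataset is uniform (so the
messages are independent and uniform) and the queries are independent of it. -/
def lawGiven {N K D L T : ℕ} (F : Type*) [Field F] [Fintype F] (S : Scheme N K D L T)
    (j : Fin (K - D + 1)) : PMF ((Fin N → Query K L T) × Dataset F K L) :=
  (S.queryLaw j).bind fun Q =>
    (PMF.uniformOfFintype (Dataset F K L)).map fun X => (Q, X)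

/-- The joint law of demand, queries and dataset when the demand has law `p`. -/
def law {N K D L T : ℕ} (F : Type*) [Field F] [Fintype F] (S : Scheme N K D L T)
    (p : PMF (Fin (K - D + 1))) :
    PMF (Fin (K - D + 1) × (Fin N → Query K L T) × Dataset F K L) :=
  p.bind fun j => (S.lawGiven F j).map fun ω => (j, ω)

/-- Correctness: for each demand, `H(X_W | Q_[1:N], A_[1:N]) = 0`. -/
def Correct {N K D L T : ℕ} (F : Type*) [Field F] [Fintype F] (S : Scheme N K D L T)
    (h : D ≤ K) : Prop :=
  ∀ j : Fin (K - D + 1),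
    condEntropy (Fintype.card F) (S.lawGiven F j)
      (fun ω => demandMessages h j ω.2)
      (fun ω => (ω.1, fun n : Fin N => answer (ω.1 n) ω.2)) = 0

/-- Privacy: for each server `n`, `I(W ; Q_n, A_n, X_[1:K]) = 0`. -/
def Private {N K D L T : ℕ} (F : Type*) [Field F] [Fintype F] (S : Scheme N K D L T)
    (p : PMF (Fin (K - D + 1))) : Prop :=
  ∀ n : Fin N,
    mutualInfo (Fintype.card F) (S.law F p)
      (fun ω => ω.1)
      (fun ω => (ω.2.1 n, answer (ω.2.1 n) ω.2.2, ω.2.2)) = 0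

/-- The retrieval rate `H(X_W) / ∑ n, H(A_n | Q_n)`. -/
def rate {N K D L T : ℕ} (F : Type*) [Field F] [Fintype F] (S : Scheme N K D L T)
    (h : D ≤ K) (p : PMF (Fin (K - D + 1))) : ℝ :=
  entropy (Fintype.card F) (S.law F p) (fun ω => demandMessages h ω.1 ω.2.2) /
    ∑ n : Fin N, condEntropy (Fintype.card F) (S.law F p)
      (fun ω => answer (ω.2.1 n) ω.2.2) (fun ω => ω.2.1 n)

end Scheme

/-- The retrieval rates `H(X_W) / ∑ n, H(A_n | Q_n)` of all correct and private balanced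
`{0,1}`-linear schemes, over all subpacketization levels `L ≥ 1` and all numbers `T` of linear
combinations per server. -/
def achievableRates (F : Type*) [Field F] [Fintype F] (N : ℕ) {K D : ℕ} (h : D ≤ K)
    (p : PMF (Fin (K - D + 1))) : Set ℝ :=
  {r | ∃ L T : ℕ, 1 ≤ L ∧ ∃ S : Scheme N K D L T,
    S.Correct F h ∧ S.Private F p ∧ r = S.rate F h p}

/-- The same with the rate counted in symbols: the number `D * L` of desired symbols over the
number `N * T` of retrieved symbols. -/
def achievableSymbolRates (F : Type*) [Field F] [Fintype F] (N : ℕ) {K D : ℕ} (h : D ≤ K)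
    (p : PMF (Fin (K - D + 1))) : Set ℝ :=
  {r | ∃ L T : ℕ, 1 ≤ L ∧ ∃ S : Scheme N K D L T,
    S.Correct F h ∧ S.Private F p ∧ r = ((D : ℝ) * L) / ((N : ℝ) * T)}

/-- `D N^f / (D N (N^f - 1) / (N - 1) + K - D f)` with `f = ⌊K / D⌋`. -/
def optimalRate (N K D : ℕ) : ℝ :=
  ((D : ℝ) * (N : ℝ) ^ (K / D)) /
    ((D : ℝ) * N * ((N : ℝ) ^ (K / D) - 1) / ((N : ℝ) - 1) + K - (D : ℝ) * ((K / D : ℕ) : ℝ))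

end PCBR

end

/-!
Both maxima rest on two reductions. Privacy is independence of the demand and a single server's
query (`Scheme.private_iff`): the answer is a function of query and dataset, and the dataset is
independent of the queries. Since the dataset is uniform and answers are linear, `H(A_n | Q_n)` in
base `|F|` is the mean rank of the query (`Scheme.condEntropy_answer`), and correctness says that a
dataset with vanishing answers has vanishing demand messages (`Scheme.correct_iff`).

*Upper bound.* Let `r(s)` be the total mean rank of the queries once the messages in `s` are set to
zero; by privacy it does not depend on the demand. For a demand window `W`, the joint answer map
loses exactly `L |W \ s|` dimensions when the messages in `W` are set to zero too, its rank is at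
most the sum of the servers' ranks and at least their average, so
`r(s) ≥ L |W \ s| + r(s ∪ W) / N` (`residualRank_step`, `Scheme.meanRank_step`). Applied to the
windows `[0, D), [D, 2D), …` and at last to the window ending at `K`, this bounds the total download
`r(∅)` from below by `D L` over the optimal rate (`Scheme.rateDenominator_mul_le`).

*Attaining it.* An interval of length `D` contains exactly one index of each residue class modulo
`D`, so retrieving a window means retrieving one message from each of `D` classes of size
`⌊K / D⌋` or `⌊K / D⌋ + 1`. Messages are cut into segments numbered by vectors
`s : Fin K → ZMod N`, each with symbols numbered by the nonzero residues, and a dummy zero symbol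
at residue `0`. With a uniform key `u`, server `n` gets the key `w = u - n • 1_W`, which is uniform
whatever `W` is, and returns for every class `c` and every vector `v` not vanishing on `c` the sum
of the symbols `v i` of segment `v + w` over the messages `i` in `c`. In a given segment, all servers
use the same symbols of the messages outside `W`, while the symbol of the message in `W` runs through
all residues. One server meets the dummy and so reveals the interference, which the user
subtracts elsewhere (`residueScheme_correct`). Counting requests gives the rate
(`card_request`, `symbolRate_residueScheme`). The entropy rate of this scheme lies between its
symbol rate and the upper bound, so it is optimal too.
-/

namespace PCBR

/-! ### Entropy on discrete probability spaces -/

lemma toReal_map_apply {α β : Type*} [Fintype α] [DecidableEq β] (P : PMF α) (f : α → β) (b : β) :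
    ((P.map f) b).toReal = ∑ a, if b = f a then (P a).toReal else 0 := by
  classical
  rw [PMF.map_apply, tsum_fintype, ENNReal.toReal_sum]
  · refine Finset.sum_congr rfl fun a _ => ?_
    by_cases h : b = f a <;> simp [h]
  · intro a _
    split_ifs
    · exact P.apply_ne_top a
    · simp

lemma sum_toReal_eq_one {α : Type*} [Fintype α] (P : PMF α) : ∑ a, (P a).toReal = 1 := by
  rw [← ENNReal.toReal_sum fun a _ => P.apply_ne_top a, ← tsum_fintype (L := .unconditional _),
    P.tsum_coe, ENNReal.toReal_one]

lemma toReal_map_fst {α β : Type*} [Fintype α] [Fintype β] (P : PMF (α × β)) (y : α) :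
    ((P.map Prod.fst) y).toReal = ∑ z, (P (y, z)).toReal := by
  classical
  rw [toReal_map_apply, Fintype.sum_prod_type, Finset.sum_eq_single y]
  · simp
  · intro x _ hx
    simp [Ne.symm hx]
  · simp

lemma toReal_map_snd {α β : Type*} [Fintype α] [Fintype β] (P : PMF (α × β)) (z : β) :
    ((P.map Prod.snd) z).toReal = ∑ y, (P (y, z)).toReal := by
  classical
  rw [toReal_map_apply, Fintype.sum_prod_type]
  refine Finset.sum_congr rfl fun y _ => ?_
  simp

lemma toReal_bind_apply {α β : Type*} [Fintype α] (P : PMF α) (κ : α → PMF β) (b : β) :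
    ((P.bind κ) b).toReal = ∑ a, (P a).toReal * (κ a b).toReal := by
  rw [PMF.bind_apply, tsum_fintype, ENNReal.toReal_sum]
  · simp
  · intro a _
    exact ENNReal.mul_ne_top (P.apply_ne_top a) ((κ a).apply_ne_top b)

/-- A bind that records its first stage has the product of the two stages as its mass function. -/
lemma toReal_bind_map_apply {α β : Type*} [Fintype α] (P : PMF α) (κ : α → PMF β) (a : α) (b : β) :
    ((P.bind fun a => (κ a).map fun b => (a, b)) (a, b)).toReal
      = (P a).toReal * (κ a b).toReal := by
  classical
  rw [toReal_bind_apply, Finset.sum_eq_single a]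
  · congr 2
    rw [PMF.map_apply, tsum_eq_single b]
    · simp
    · intro b' hb'
      simp [Ne.symm hb']
  · intro a' _ ha'
    have : ((κ a').map fun b => (a', b)) (a, b) = 0 := by
      rw [PMF.apply_eq_zero_iff, PMF.mem_support_map_iff]
      rintro ⟨x, -, hx⟩
      exact ha' (Prod.ext_iff.1 hx).1
    simp [this]
  · simp

lemma toReal_le_of_prod {α β : Type*} [Fintype α] [Fintype β] (P : PMF (α × β)) (y : α) (z : β) :
    (P (y, z)).toReal ≤ ((P.map Prod.snd) z).toReal := by
  rw [toReal_map_snd]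
  exact Finset.single_le_sum (f := fun y => (P (y, z)).toReal)
    (fun _ _ => ENNReal.toReal_nonneg) (Finset.mem_univ y)

section Entropy

variable {Ω α β : Type*} [Fintype α] [Fintype β] {b : ℝ}

lemma entropy_congr {Ω' : Type*} {μ : PMF Ω} {μ' : PMF Ω'} {Y : Ω → α} {Y' : Ω' → α}
    (h : μ.map Y = μ'.map Y') : entropy b μ Y = entropy b μ' Y' := by
  simp only [entropy, h]

lemma condEntropy_eq_sum (μ : PMF Ω) (Y : Ω → α) (Z : Ω → β) :
    condEntropy b μ Y Z =
      (∑ z, ∑ y, (((μ.map fun ω => (Y ω, Z ω)) (y, z)).toReal *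
        (Real.log ((μ.map Z) z).toReal
          - Real.log ((μ.map fun ω => (Y ω, Z ω)) (y, z)).toReal))) / Real.log b := by
  set P := μ.map fun ω => (Y ω, Z ω) with hP
  have hZ : μ.map Z = P.map Prod.snd := by rw [hP, PMF.map_comp]; rfl
  unfold condEntropy entropy
  rw [← Finset.sum_div, ← Finset.sum_div, ← sub_div, hZ, ← hP, Fintype.sum_prod_type_right,
    ← Finset.sum_sub_distrib]
  congr 1
  refine Finset.sum_congr rfl fun z _ => ?_
  simp only [mul_sub, Finset.sum_sub_distrib, ← Finset.sum_mul, ← toReal_map_snd, Real.negMulLog,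
    neg_mul, Finset.sum_neg_distrib]
  ring

/-- `H(Y | Z) = 0` exactly when `Z` determines `Y` on the support. -/
lemma condEntropy_eq_zero_iff (hb : 1 < b) (μ : PMF Ω) (Y : Ω → α) (Z : Ω → β) :
    condEntropy b μ Y Z = 0 ↔
      ∀ ω ∈ μ.support, ∀ ω' ∈ μ.support, Z ω = Z ω' → Y ω = Y ω' := by
  classical
  rw [condEntropy_eq_sum]
  set P := μ.map fun ω => (Y ω, Z ω) with hP
  have hZ : μ.map Z = P.map Prod.snd := by rw [hP, PMF.map_comp]; rfl
  rw [hZ, div_eq_zero_iff, or_iff_left (Real.log_pos hb).ne']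
  have hnn : ∀ z y, 0 ≤ (P (y, z)).toReal *
      (Real.log ((P.map Prod.snd) z).toReal - Real.log (P (y, z)).toReal) := by
    intro z y
    rcases (ENNReal.toReal_nonneg (a := P (y, z))).eq_or_lt with h | h
    · simp [← h]
    · exact mul_nonneg h.le (sub_nonneg.2 (Real.log_le_log h (toReal_le_of_prod P y z)))
  rw [Finset.sum_eq_zero_iff_of_nonneg fun z _ => Finset.sum_nonneg fun y _ => hnn z y]
  simp only [Finset.sum_eq_zero_iff_of_nonneg fun y _ => hnn _ y, Finset.mem_univ, true_imp_iff]
  have hpos : ∀ ω ∈ μ.support, 0 < (P (Y ω, Z ω)).toReal := fun ω hω =>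
    ENNReal.toReal_pos ((PMF.mem_support_iff _ _).1
      ((PMF.mem_support_map_iff _ _ _).2 ⟨ω, hω, rfl⟩)) (P.apply_ne_top _)
  constructor
  · -- every atom of the joint law carries the whole mass of its value of `Z`
    intro h ω hω ω' hω' hzz
    by_contra hne
    have key : ∀ ω ∈ μ.support,
        ((P.map Prod.snd) (Z ω)).toReal = (P (Y ω, Z ω)).toReal := by
      intro ω hω
      have h1 := hpos ω hω
      have h2 := (mul_eq_zero.1 (h (Z ω) (Y ω))).resolve_left h1.ne'
      exact Real.log_injOn_pos (h1.trans_le (toReal_le_of_prod P _ _)) h1 (sub_eq_zero.1 h2)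
    have h1 := key ω hω
    have h2 := key ω' hω'
    have h3 := hpos ω hω
    rw [← hzz] at h2
    have h4 : (P (Y ω, Z ω)).toReal + (P (Y ω', Z ω)).toReal ≤ ((P.map Prod.snd) (Z ω)).toReal := by
      rw [toReal_map_snd, ← Finset.sum_pair (f := fun y => (P (y, Z ω)).toReal) hne]
      exact Finset.sum_le_sum_of_subset_of_nonneg (Finset.subset_univ _)
        fun _ _ _ => ENNReal.toReal_nonneg
    linarith
  · intro h z y
    by_cases hyz : P (y, z) = 0
    · simp [hyz]
    obtain ⟨ω, hω, hωe⟩ := (PMF.mem_support_map_iff _ _ _).1 ((PMF.mem_support_iff _ _).2 hyz)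
    obtain ⟨rfl, rfl⟩ := Prod.ext_iff.1 hωe
    rw [toReal_map_snd, Finset.sum_eq_single (Y ω)]
    · simp
    · intro y' _ hy'
      have : P (y', Z ω) = 0 := by
        rw [PMF.apply_eq_zero_iff, hP, PMF.mem_support_map_iff]
        rintro ⟨ω', hω', he⟩
        exact hy' ((Prod.ext_iff.1 he).1.symm.trans (h ω' hω' ω hω (Prod.ext_iff.1 he).2))
      simp [this]
    · simp

/-- Mutual information vanishes exactly for independent variables: it is the Kullback–Leibler
divergence of the joint law from the product of the marginals, so the equality case of Gibbs'
inequality applies. -/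
lemma mutualInfo_eq_zero_iff (hb : 1 < b) (μ : PMF Ω) (Y : Ω → α) (Z : Ω → β) :
    mutualInfo b μ Y Z = 0 ↔
      ∀ y z, ((μ.map fun ω => (Y ω, Z ω)) (y, z)).toReal
        = ((μ.map Y) y).toReal * ((μ.map Z) z).toReal := by
  classical
  unfold mutualInfo entropy
  set P := μ.map fun ω => (Y ω, Z ω) with hP
  have hY : μ.map Y = P.map Prod.fst := by rw [hP, PMF.map_comp]; rfl
  have hZ : μ.map Z = P.map Prod.snd := by rw [hP, PMF.map_comp]; rfl
  rw [hY, hZ, ← Finset.sum_div, ← Finset.sum_div, ← Finset.sum_div, ← add_div, ← sub_div,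
    div_eq_zero_iff, or_iff_left (Real.log_pos hb).ne']
  set a : α → β → ℝ := fun y z => (P (y, z)).toReal with ha
  set u : α → ℝ := fun y => ((P.map Prod.fst) y).toReal with hu
  set v : β → ℝ := fun z => ((P.map Prod.snd) z).toReal with hv
  have hau : ∀ y, u y = ∑ z, a y z := fun y => toReal_map_fst P y
  have hav : ∀ z, v z = ∑ y, a y z := fun z => toReal_map_snd P z
  have ha0 : ∀ y z, 0 ≤ a y z := fun _ _ => ENNReal.toReal_nonneg
  have hu0 : ∀ y, 0 ≤ u y := fun _ => ENNReal.toReal_nonneg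
  have hv0 : ∀ z, 0 ≤ v z := fun _ => ENNReal.toReal_nonneg
  have hle1 : ∀ y z, a y z ≤ u y := fun y z => by
    rw [hau]; exact Finset.single_le_sum (fun z _ => ha0 y z) (Finset.mem_univ z)
  have hle2 : ∀ y z, a y z ≤ v z := fun y z => by
    rw [hav]; exact Finset.single_le_sum (f := fun y => a y z) (fun y _ => ha0 y z)
      (Finset.mem_univ y)
  have hsu : ∑ y, u y = 1 := sum_toReal_eq_one _
  have hsv : ∑ z, v z = 1 := sum_toReal_eq_one _
  have hterm : ∀ y z, a y z * Real.log (a y z) - a y z * Real.log (u y) - a y z * Real.log (v z)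
      = u y * v z * InformationTheory.klFun (a y z / (u y * v z)) + (a y z - u y * v z) := by
    intro y z
    rcases (ha0 y z).eq_or_lt with h | h
    · simp [← h, InformationTheory.klFun_zero]
    · have h1 := h.trans_le (hle1 y z)
      have h2 := h.trans_le (hle2 y z)
      rw [InformationTheory.klFun_apply, Real.log_div h.ne' (mul_pos h1 h2).ne',
        Real.log_mul h1.ne' h2.ne']
      field_simp
      ring
  have e1 : ∑ y, Real.negMulLog (u y) = - ∑ y, ∑ z, a y z * Real.log (u y) := by
    rw [← Finset.sum_neg_distrib]
    refine Finset.sum_congr rfl fun y _ => ?_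
    rw [← Finset.sum_mul, ← hau, Real.negMulLog, neg_mul]
  have e2 : ∑ z, Real.negMulLog (v z) = - ∑ y, ∑ z, a y z * Real.log (v z) := by
    rw [Finset.sum_comm, ← Finset.sum_neg_distrib]
    refine Finset.sum_congr rfl fun z _ => ?_
    rw [← Finset.sum_mul, ← hav, Real.negMulLog, neg_mul]
  have e3 : ∑ x : α × β, Real.negMulLog (P x).toReal = - ∑ y, ∑ z, a y z * Real.log (a y z) := by
    rw [Fintype.sum_prod_type, ← Finset.sum_neg_distrib]
    refine Finset.sum_congr rfl fun y _ => ?_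
    rw [← Finset.sum_neg_distrib]
    refine Finset.sum_congr rfl fun z _ => ?_
    rw [Real.negMulLog, neg_mul]
  have e4 : ∑ y, ∑ z, (a y z - u y * v z) = 0 := by
    simp only [Finset.sum_sub_distrib, ← Finset.mul_sum, hsv, mul_one, ← hau, sub_self,
      Finset.sum_const_zero]
  have e5 : ∑ y, Real.negMulLog (u y) + ∑ z, Real.negMulLog (v z)
      - ∑ x : α × β, Real.negMulLog (P x).toReal
      = ∑ y, ∑ z, u y * v z * InformationTheory.klFun (a y z / (u y * v z)) := by
    rw [e1, e2, e3]
    have : ∑ y, ∑ z, (u y * v z * InformationTheory.klFun (a y z / (u y * v z))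
          + (a y z - u y * v z))
        = ∑ y, ∑ z, u y * v z * InformationTheory.klFun (a y z / (u y * v z)) := by
      simp only [Finset.sum_add_distrib] at e4 ⊢
      linarith
    rw [← this]
    simp only [← hterm, Finset.sum_sub_distrib]
    ring
  have hk0 : ∀ y z, 0 ≤ u y * v z * InformationTheory.klFun (a y z / (u y * v z)) := fun y z =>
    mul_nonneg (mul_nonneg (hu0 y) (hv0 z)) (InformationTheory.klFun_nonneg
      (div_nonneg (ha0 y z) (mul_nonneg (hu0 y) (hv0 z))))
  rw [e5, Finset.sum_eq_zero_iff_of_nonneg fun y _ => Finset.sum_nonneg fun z _ => hk0 y z]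
  simp only [Finset.sum_eq_zero_iff_of_nonneg fun z _ => hk0 _ z, Finset.mem_univ, true_imp_iff]
  refine forall₂_congr fun y z => ?_
  change _ ↔ a y z = u y * v z
  rcases (mul_nonneg (hu0 y) (hv0 z)).eq_or_lt with h | h
  · rw [← h]
    have : a y z = 0 := by
      rcases mul_eq_zero.1 h.symm with h | h
      · exact le_antisymm (h ▸ hle1 y z) (ha0 y z)
      · exact le_antisymm (h ▸ hle2 y z) (ha0 y z)
    simp [this]
  · rw [mul_eq_zero, or_iff_right h.ne', InformationTheory.klFun_eq_zero_iff
      (div_nonneg (ha0 y z) h.le), div_eq_one_iff_eq h.ne']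

/-- If the joint law of `(Y, Z)` is drawn in two stages, first `Z` from `ν` and then `Y` from
`κ Z`, then `H(Y | Z)` is the mean of the entropies of the laws `κ z`. -/
lemma condEntropy_of_bind (μ : PMF Ω) (Y : Ω → α) (Z : Ω → β) (ν : PMF β) (κ : β → PMF α)
    (h : (μ.map fun ω => (Z ω, Y ω)) = ν.bind fun z => (κ z).map fun y => (z, y)) :
    condEntropy b μ Y Z = ∑ z, (ν z).toReal * entropy b (κ z) id := by
  have hP : ∀ y z, ((μ.map fun ω => (Y ω, Z ω)) (y, z)).toReal
      = (ν z).toReal * (κ z y).toReal := by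
    intro y z
    have h1 : (μ.map fun ω => (Y ω, Z ω)) = (μ.map fun ω => (Z ω, Y ω)).map Prod.swap := by
      rw [PMF.map_comp]; rfl
    have h2 : ((μ.map fun ω => (Y ω, Z ω)) (y, z)) = (μ.map fun ω => (Z ω, Y ω)) (z, y) := by
      classical
      rw [h1, PMF.map_apply, tsum_eq_single (z, y)]
      · simp
      · rintro ⟨z', y'⟩ hne
        rw [if_neg]
        rintro hh
        simp only [Prod.swap_prod_mk, Prod.mk.injEq] at hh
        exact hne (by rw [hh.1, hh.2])
    rw [h2, h, toReal_bind_map_apply]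
  have hZ : μ.map Z = ν := by
    have : μ.map Z = (μ.map fun ω => (Z ω, Y ω)).map Prod.fst := by rw [PMF.map_comp]; rfl
    rw [this, h, PMF.map_bind]
    simp only [PMF.map_comp]
    refine Eq.trans ?_ ν.bind_pure
    congr 1
    funext z
    exact PMF.map_const _ _
  unfold condEntropy entropy
  rw [hZ, Fintype.sum_prod_type_right, ← Finset.sum_sub_distrib]
  refine Finset.sum_congr rfl fun z _ => ?_
  simp only [hP, Real.negMulLog_mul, PMF.map_id]
  rw [← Finset.sum_div, ← Finset.sum_div, ← sub_div, ← mul_div_assoc, Finset.sum_add_distrib,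
    ← Finset.sum_mul, ← Finset.mul_sum, sum_toReal_eq_one]
  congr 1
  ring

/-- A law that is uniform on a set of size `c` has entropy `log c`. -/
lemma entropy_of_uniform_on [DecidableEq α] (μ : PMF Ω) (Y : Ω → α) (s : Finset α)
    (h : ∀ y, ((μ.map Y) y).toReal = if y ∈ s then (s.card : ℝ)⁻¹ else 0) :
    entropy b μ Y = Real.log s.card / Real.log b := by
  classical
  have hs : (s.card : ℝ) ≠ 0 := by
    intro h0
    have h1 := sum_toReal_eq_one (μ.map Y)
    rw [Finset.sum_congr rfl fun y _ => h y] at h1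
    simp [h0] at h1
  unfold entropy
  simp only [h, apply_ite Real.negMulLog, Real.negMulLog_zero]
  rw [← Finset.sum_div, Finset.sum_ite_mem, Finset.univ_inter, Finset.sum_const, nsmul_eq_mul,
    Real.negMulLog, Real.log_inv]
  congr 1
  field_simp

end Entropy

/-- A linear image of a uniform vector is uniform on the range. -/
lemma toReal_uniform_map_linear {F V W : Type*} [Field F] [AddCommGroup V] [Module F V]
    [AddCommGroup W] [Module F W] [Fintype V] [Fintype W] (f : V →ₗ[F] W) [DecidableEq W] (w : W) :
    (((PMF.uniformOfFintype V).map f) w).toReal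
      = if w ∈ (Finset.univ.image f) then ((Finset.univ.image f).card : ℝ)⁻¹ else 0 := by
  classical
  set P := (PMF.uniformOfFintype V).map f with hP
  have hval : ∀ w, (P w).toReal = ((Finset.univ.filter fun x => f x = w).card : ℝ)
      * (Fintype.card V : ℝ)⁻¹ := by
    intro w
    rw [hP, toReal_map_apply, ← Finset.sum_filter]
    simp [eq_comm]
  have hout : ∀ w, w ∉ Finset.univ.image f → (P w).toReal = 0 := by
    intro w hw
    rw [hval, Finset.filter_eq_empty_iff.2]
    · simp
    · intro x _ hx
      exact hw (Finset.mem_image.2 ⟨x, Finset.mem_univ _, hx⟩)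
  have hconst : ∀ w ∈ Finset.univ.image f, (P w).toReal = (P 0).toReal := by
    intro w hw
    obtain ⟨x, -, hx⟩ := Finset.mem_image.1 hw
    rw [hval, hval, AddMonoidHom.card_fiber_eq_of_mem_range f ⟨x, hx⟩ ⟨0, map_zero f⟩]
  have hsum := sum_toReal_eq_one P
  rw [← Finset.sum_subset (Finset.subset_univ (Finset.univ.image f)) fun w _ hw => hout w hw,
    Finset.sum_congr rfl hconst, Finset.sum_const, nsmul_eq_mul] at hsum
  split_ifs with h
  · rw [hconst w h]
    exact eq_inv_of_mul_eq_one_right hsum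
  · exact hout w h

/-- In base `|F|`, the entropy of a linear image of a uniform vector over `F` is the rank. -/
lemma entropy_uniform_linear {F V W : Type*} [Field F] [Fintype F] [AddCommGroup V] [Module F V]
    [AddCommGroup W] [Module F W] [Fintype V] [Fintype W] (f : V →ₗ[F] W) :
    entropy (Fintype.card F) (PMF.uniformOfFintype V) f = Module.finrank F (LinearMap.range f) := by
  classical
  rw [entropy_of_uniform_on _ _ _ (toReal_uniform_map_linear f)]
  have hcard : (Finset.univ.image f).card
      = Fintype.card F ^ Module.finrank F (LinearMap.range f) := by
    rw [← Module.card_eq_pow_finrank (K := F) (V := LinearMap.range f)]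
    exact (Fintype.card_of_subtype _ (by simp)).symm
  have : Real.log (Fintype.card F) ≠ 0 :=
    (Real.log_pos (by exact_mod_cast Fintype.one_lt_card)).ne'
  rw [hcard, Nat.cast_pow, Real.log_pow]
  field_simp

/-! ### Schemes in terms of query marginals and linear maps -/

section Linear

variable {F : Type*} [Field F] {K L T : ℕ}

/-- The answer to a fixed query as a linear function of the dataset. -/
def answerLinear (F : Type*) [Field F] {K L T : ℕ} (q : Query K L T) :
    Dataset F K L →ₗ[F] (Fin T → F) where
  toFun := answer q
  map_add' X Y := by
    funext t
    simp [answer, mul_add, Finset.sum_add_distrib]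
  map_smul' c X := by
    funext t
    simp only [answer, Pi.smul_apply, smul_eq_mul, RingHom.id_apply, Finset.mul_sum]
    exact Finset.sum_congr rfl fun i _ => Finset.sum_congr rfl fun l _ => by ring

@[simp] lemma coe_answerLinear (q : Query K L T) : ⇑(answerLinear F q) = answer q := rfl

/-- All answers to a tuple of queries, as a linear function of the dataset. -/
def answersLinear (F : Type*) [Field F] {N K L T : ℕ} (Q : Fin N → Query K L T) :
    Dataset F K L →ₗ[F] (Fin N → Fin T → F) :=
  LinearMap.pi fun n => answerLinear F (Q n)

end Linear

namespace Scheme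

variable {N K D L T : ℕ} {F : Type*} [Field F] [Fintype F]

/-- The law of the query to server `n` for demand number `j`. -/
noncomputable def queryMarginal (S : Scheme N K D L T) (n : Fin N) (j : Fin (K - D + 1)) : PMF (Query K L T) :=
  (S.queryLaw j).map fun Q => Q n

lemma lawGiven_map_server (S : Scheme N K D L T) (n : Fin N) (j : Fin (K - D + 1)) {α : Type*}
    (φ : Query K L T → Dataset F K L → α) :
    (S.lawGiven F j).map (fun ω => φ (ω.1 n) ω.2)
      = (S.queryMarginal n j).bind fun q => (PMF.uniformOfFintype (Dataset F K L)).map (φ q) := by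
  unfold lawGiven queryMarginal
  rw [PMF.map_bind, PMF.bind_map]
  simp only [PMF.map_comp]
  rfl

lemma law_map (S : Scheme N K D L T) (p : PMF (Fin (K - D + 1))) {α : Type*}
    (φ : Fin (K - D + 1) → (Fin N → Query K L T) × Dataset F K L → α) :
    (S.law F p).map (fun ω => φ ω.1 ω.2) = p.bind fun j => (S.lawGiven F j).map (φ j) := by
  unfold law
  rw [PMF.map_bind]
  simp only [PMF.map_comp]
  rfl

lemma one_lt_card_real (F : Type*) [Field F] [Fintype F] : (1 : ℝ) < Fintype.card F := by
  exact_mod_cast Fintype.one_lt_card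

/-- Privacy says that the law of the query to a single server does not depend on the demand: the
dataset is independent of the queries and the answer is a function of both. -/
lemma private_iff (S : Scheme N K D L T) {p : PMF (Fin (K - D + 1))} (hp : ∀ j, p j ≠ 0) :
    S.Private F p ↔ ∀ n j j', S.queryMarginal n j = S.queryMarginal n j' := by
  unfold Private
  refine forall_congr' fun n => ?_
  rw [mutualInfo_eq_zero_iff (one_lt_card_real F)]
  set φ : Query K L T → Dataset F K L → Query K L T × (Fin T → F) × Dataset F K L :=
    fun q X => (q, answer q X, X) with hφ
  set κ : Fin (K - D + 1) → PMF (Query K L T × (Fin T → F) × Dataset F K L) := fun j =>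
    (S.queryMarginal n j).bind fun q => (PMF.uniformOfFintype (Dataset F K L)).map (φ q) with hκ
  have hκ' : ∀ j, (S.lawGiven F j).map (fun ω => φ (ω.1 n) ω.2) = κ j := fun j =>
    S.lawGiven_map_server n j φ
  have hjoint : (S.law F p).map (fun ω => (ω.1, (ω.2.1 n, answer (ω.2.1 n) ω.2.2, ω.2.2)))
      = p.bind fun j => (κ j).map fun z => (j, z) := by
    rw [S.law_map p fun j ω => (j, φ (ω.1 n) ω.2)]
    congr 1
    funext j
    rw [← hκ', PMF.map_comp]
    rfl
  have hW : (S.law F p).map (fun ω => ω.1) = p := by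
    rw [S.law_map p fun j _ => j]
    refine Eq.trans ?_ p.bind_pure
    congr 1
    funext j
    exact PMF.map_const _ _
  have hZ : (S.law F p).map (fun ω => (ω.2.1 n, answer (ω.2.1 n) ω.2.2, ω.2.2)) = p.bind κ := by
    rw [S.law_map p fun j ω => φ (ω.1 n) ω.2]
    exact congrArg p.bind (funext hκ')
  have hfst : ∀ j, (κ j).map Prod.fst = S.queryMarginal n j := by
    intro j
    rw [hκ, PMF.map_bind]
    refine Eq.trans ?_ (PMF.bind_pure _)
    congr 1
    funext q
    rw [PMF.map_comp]
    exact PMF.map_const _ _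
  rw [hjoint, hW, hZ]
  simp only [toReal_bind_map_apply]
  constructor
  · intro h j j'
    have key : ∀ j, κ j = p.bind κ := by
      intro j
      refine PMF.ext fun z => (ENNReal.toReal_eq_toReal_iff' (PMF.apply_ne_top _ _)
        (PMF.apply_ne_top _ _)).1 ?_
      exact mul_left_cancel₀ (ENNReal.toReal_pos (hp j) (p.apply_ne_top j)).ne' (h j z)
    rw [← hfst, ← hfst, key j, key j']
  · intro h j z
    have : κ = fun _ => κ j := by
      funext j'
      simp only [hκ, h j' j]
    rw [this, PMF.bind_const]

/-- Correctness is a statement about kernels: for every query tuple in use, datasets whose answers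
vanish have vanishing demand messages. -/
lemma correct_iff (S : Scheme N K D L T) (h : D ≤ K) :
    S.Correct F h ↔ ∀ j, ∀ Q ∈ (S.queryLaw j).support, ∀ X : Dataset F K L,
      answersLinear F Q X = 0 → demandMessages h j X = 0 := by
  unfold Correct
  refine forall_congr' fun j => ?_
  rw [condEntropy_eq_zero_iff (one_lt_card_real F)]
  have hsupp : ∀ ω : (Fin N → Query K L T) × Dataset F K L,
      ω ∈ (S.lawGiven F j).support ↔ ω.1 ∈ (S.queryLaw j).support := by
    rintro ⟨Q, X⟩
    unfold lawGiven
    rw [PMF.mem_support_bind_iff]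
    simp only [PMF.mem_support_map_iff, Prod.mk.injEq]
    exact ⟨fun ⟨Q', h, X', _, h1, h2⟩ => h1 ▸ h, fun h =>
      ⟨Q, h, X, PMF.mem_support_uniformOfFintype X, rfl, rfl⟩⟩
  constructor
  · intro H Q hQ X hX
    refine H (Q, X) ((hsupp _).2 hQ) (Q, 0) ((hsupp _).2 hQ) ?_
    have h0 : answersLinear F Q (0 : Dataset F K L) = 0 := map_zero _
    exact Prod.ext rfl (hX.trans h0.symm)
  · rintro H ⟨Q, X⟩ hω ⟨Q', X'⟩ hω' he
    obtain ⟨rfl, he⟩ := Prod.ext_iff.1 he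
    have hz : answersLinear F Q (X - X') = 0 := by
      rw [map_sub, sub_eq_zero]
      exact he
    have := H Q ((hsupp _).1 hω) (X - X') hz
    funext d
    exact sub_eq_zero.1 (congrFun this d)

/-- `H(A_n | Q_n)` is the mean rank of the query to server `n`. -/
lemma condEntropy_answer (S : Scheme N K D L T) {p : PMF (Fin (K - D + 1))} (hp : ∀ j, p j ≠ 0)
    (hS : S.Private F p) (n : Fin N) :
    condEntropy (Fintype.card F) (S.law F p)
      (fun ω => answer (ω.2.1 n) ω.2.2) (fun ω => ω.2.1 n)
      = ∑ q, (S.queryMarginal n 0 q).toReal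
          * (Module.finrank F (LinearMap.range (answerLinear F q)) : ℝ) := by
  rw [condEntropy_of_bind _ _ _ (S.queryMarginal n 0)
    fun q => (PMF.uniformOfFintype (Dataset F K L)).map (answer q)]
  · refine Finset.sum_congr rfl fun q _ => ?_
    rw [← entropy_uniform_linear]
    congr 1
    exact entropy_congr (by rw [PMF.map_id, coe_answerLinear])
  · rw [S.law_map p fun j ω => (ω.1 n, answer (ω.1 n) ω.2)]
    have : ∀ j, (S.lawGiven F j).map (fun ω => (ω.1 n, answer (ω.1 n) ω.2))
        = (S.queryMarginal n 0).bind fun q =>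
          ((PMF.uniformOfFintype (Dataset F K L)).map (answer q)).map fun y => (q, y) := by
      intro j
      rw [S.lawGiven_map_server n j fun q X => (q, answer q X), (S.private_iff hp).1 hS n j 0]
      simp only [PMF.map_comp]
      rfl
    simp only [this, PMF.bind_const]

lemma demandIndex_injective (h : D ≤ K) (j : Fin (K - D + 1)) :
    Function.Injective (demandIndex h j) := by
  intro d d' hd
  simpa [demandIndex, Fin.ext_iff] using hd

/-- `H(X_W) = D L`. -/
lemma entropy_demand (S : Scheme N K D L T) (h : D ≤ K) (p : PMF (Fin (K - D + 1))) :
    entropy (Fintype.card F) (S.law F p) (fun ω => demandMessages h ω.1 ω.2.2)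
      = (D : ℝ) * L := by
  set g : Fin (K - D + 1) → Dataset F K L →ₗ[F] (Fin D → Fin L → F) := fun j =>
    LinearMap.funLeft F (Fin L → F) (demandIndex h j) with hg
  have hsurj : ∀ j, Function.Surjective (g j) := fun j =>
    LinearMap.funLeft_surjective_of_injective F _ _ (demandIndex_injective h j)
  have hrank : ∀ j, Module.finrank F (LinearMap.range (g j)) = D * L := by
    intro j
    rw [LinearMap.range_eq_top.2 (hsurj j), finrank_top, Module.finrank_pi_fintype]
    simp
  have hmap : ∀ j, (S.lawGiven F j).map (fun ω => demandMessages h j ω.2)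
      = (PMF.uniformOfFintype (Dataset F K L)).map (g j) := by
    intro j
    unfold lawGiven
    rw [PMF.map_bind]
    simp only [PMF.map_comp]
    exact PMF.bind_const (S.queryLaw j) ((PMF.uniformOfFintype (Dataset F K L)).map (g j))
  have huni : ∀ j, (PMF.uniformOfFintype (Dataset F K L)).map (g j)
      = (PMF.uniformOfFintype (Dataset F K L)).map (g 0) := by
    classical
    intro j
    refine PMF.ext fun z => (ENNReal.toReal_eq_toReal_iff' (PMF.apply_ne_top _ _)
        (PMF.apply_ne_top _ _)).1 ?_
    rw [toReal_uniform_map_linear, toReal_uniform_map_linear,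
      Finset.image_univ_of_surjective (hsurj j), Finset.image_univ_of_surjective (hsurj 0)]
  rw [entropy_congr (μ' := PMF.uniformOfFintype (Dataset F K L)) (Y' := g 0),
    entropy_uniform_linear, hrank]
  · push_cast
    rfl
  · rw [S.law_map p fun j ω => demandMessages h j ω.2]
    simp only [hmap, huni, PMF.bind_const]

end Scheme

/-! ### The upper bound on the rate -/

section Rank

variable {F V : Type*} [Field F] [AddCommGroup V] [Module F V] [FiniteDimensional F V]

lemma finrank_map_add_finrank_ker_inf {W : Type*} [AddCommGroup W] [Module F W]
    (f : V →ₗ[F] W) (U : Submodule F V) :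
    Module.finrank F (U.map f) + Module.finrank F (LinearMap.ker f ⊓ U : Submodule F V)
      = Module.finrank F U := by
  rw [← LinearMap.finrank_range_add_finrank_ker (f.domRestrict U), LinearMap.range_domRestrict,
    LinearMap.ker_domRestrict, inf_comm, ← Submodule.map_comap_subtype,
    Submodule.finrank_map_subtype_eq]

/-- If `ker f ≤ U'`, then passing from `U` to `U ⊓ U'` lowers the dimension of the image under `f`
by as much as the dimension itself. -/
lemma finrank_map_add_of_ker_le {W : Type*} [AddCommGroup W] [Module F W]
    (f : V →ₗ[F] W) (U U' : Submodule F V) (h : LinearMap.ker f ≤ U') :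
    Module.finrank F (U.map f) + Module.finrank F (U ⊓ U' : Submodule F V)
      = Module.finrank F ((U ⊓ U').map f) + Module.finrank F U := by
  have h1 := finrank_map_add_finrank_ker_inf f U
  have h2 := finrank_map_add_finrank_ker_inf f (U ⊓ U')
  have h3 : LinearMap.ker f ⊓ (U ⊓ U') = LinearMap.ker f ⊓ U := by
    rw [inf_comm U U', ← inf_assoc, inf_eq_left.2 h]
  rw [h3] at h2
  omega

variable {ι W : Type*} [AddCommGroup W] [Module F W]

lemma finrank_map_pi_le_sum [Fintype ι] (f : ι → V →ₗ[F] W) (U : Submodule F V) :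
    Module.finrank F (U.map (LinearMap.pi f)) ≤ ∑ n, Module.finrank F (U.map (f n)) := by
  rw [← Module.finrank_pi_fintype F (M := fun n => U.map (f n))]
  have hmem : ∀ n, ∀ y ∈ U.map (LinearMap.pi f), LinearMap.proj (R := F) (φ := fun _ => W) n y
      ∈ U.map (f n) := by
    rintro n y ⟨x, hx, rfl⟩
    exact ⟨x, hx, rfl⟩
  refine LinearMap.finrank_le_finrank_of_injective
    (f := LinearMap.pi fun n => (LinearMap.proj n).restrict (hmem n)) ?_
  intro y y' hyy
  refine Subtype.ext (funext fun n => ?_)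
  exact congrArg Subtype.val (congrFun hyy n)

lemma finrank_map_le_finrank_map_pi (f : ι → V →ₗ[F] W) (U : Submodule F V) (n : ι) :
    Module.finrank F (U.map (f n)) ≤ Module.finrank F (U.map (LinearMap.pi f)) := by
  have : U.map (f n) = (U.map (LinearMap.pi f)).map (LinearMap.proj n) := by
    rw [← Submodule.map_comp, LinearMap.proj_pi]
  rw [this]
  exact Submodule.finrank_map_le _ _

end Rank

section Converse

variable {F : Type*} [Field F] {N K D L T : ℕ}

/-- The datasets whose messages with index in `s` are zero. -/
def vanishing (F : Type*) [Field F] (K L : ℕ) (s : Finset (Fin K)) :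
    Submodule F (Dataset F K L) :=
  ⨅ i ∈ (s : Set (Fin K)), LinearMap.ker (LinearMap.proj (R := F) (φ := fun _ => Fin L → F) i)

lemma mem_vanishing {s : Finset (Fin K)} {X : Dataset F K L} :
    X ∈ vanishing F K L s ↔ ∀ i ∈ s, X i = 0 := by
  simp [vanishing]

lemma vanishing_empty : vanishing F K L ∅ = ⊤ := by
  simp [vanishing]

lemma vanishing_union (s t : Finset (Fin K)) :
    vanishing F K L (s ∪ t) = vanishing F K L s ⊓ vanishing F K L t := by
  ext X
  simp only [Submodule.mem_inf, mem_vanishing, Finset.mem_union, or_imp, forall_and]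

lemma finrank_vanishing (s : Finset (Fin K)) :
    Module.finrank F (vanishing F K L s) = sᶜ.card * L := by
  classical
  have e := LinearMap.iInfKerProjEquiv F (fun _ : Fin K => Fin L → F)
    (I := ((sᶜ : Finset (Fin K)) : Set (Fin K))) (J := (s : Set (Fin K)))
    (by rw [Finset.disjoint_coe]; exact disjoint_compl_left)
    (by rw [← Finset.coe_union]; simp)
  unfold vanishing
  rw [e.finrank_eq, Module.finrank_pi_fintype]
  simp

/-- The rank of a query once the messages with index in `s` are known. -/
noncomputable def residualRank (F : Type*) [Field F] {K L T : ℕ} (s : Finset (Fin K)) (q : Query K L T) : ℕ :=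
  Module.finrank F ((vanishing F K L s).map (answerLinear F q))

lemma residualRank_empty (q : Query K L T) :
    residualRank F ∅ q = Module.finrank F (LinearMap.range (answerLinear F q)) := by
  rw [residualRank, vanishing_empty, Submodule.map_top]

lemma residualRank_le (s : Finset (Fin K)) (q : Query K L T) : residualRank F s q ≤ T := by
  refine (Submodule.finrank_le _).trans ?_
  simp

/-- The core of the converse, for fixed queries: retrieving the messages in `w` costs their size
beyond `s`, and what the servers send about the other messages is at least the average, over the
servers, of the residual ranks. -/
lemma residualRank_step (Q : Fin N → Query K L T) (s w : Finset (Fin K))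
    (h : LinearMap.ker (answersLinear F Q) ≤ vanishing F K L w) :
    N * (L * (w \ s).card) + ∑ n, residualRank F (s ∪ w) (Q n)
      ≤ N * ∑ n, residualRank F s (Q n) := by
  have h1 := finrank_map_add_of_ker_le (answersLinear F Q) (vanishing F K L s) _ h
  rw [← vanishing_union, finrank_vanishing, finrank_vanishing] at h1
  have hc : sᶜ.card = (s ∪ w)ᶜ.card + (w \ s).card := by
    have : sᶜ = (s ∪ w)ᶜ ∪ (w \ s) := by
      ext i
      simp only [Finset.mem_compl, Finset.mem_union, Finset.mem_sdiff]
      tauto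
    rw [this, Finset.card_union_of_disjoint]
    rw [Finset.disjoint_left]
    intro i
    simp only [Finset.mem_compl, Finset.mem_union, Finset.mem_sdiff]
    tauto
  have h2 : Module.finrank F ((vanishing F K L s).map (answersLinear F Q))
      ≤ ∑ n, residualRank F s (Q n) := finrank_map_pi_le_sum _ _
  have h3 : ∑ n, residualRank F (s ∪ w) (Q n)
      ≤ N * Module.finrank F ((vanishing F K L (s ∪ w)).map (answersLinear F Q)) := by
    refine (Finset.sum_le_sum fun n _ => finrank_map_le_finrank_map_pi
      (fun n => answerLinear F (Q n)) (vanishing F K L (s ∪ w)) n).trans ?_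
    rw [Finset.sum_const, Finset.card_univ, Fintype.card_fin, smul_eq_mul]
    exact le_rfl
  have h4 : Module.finrank F ((vanishing F K L s).map (answersLinear F Q))
      = Module.finrank F ((vanishing F K L (s ∪ w)).map (answersLinear F Q))
        + L * (w \ s).card := by
    rw [hc] at h1
    linarith
  calc _ ≤ N * (L * (w \ s).card)
        + N * Module.finrank F ((vanishing F K L (s ∪ w)).map (answersLinear F Q)) := by gcongr
    _ = N * Module.finrank F ((vanishing F K L s).map (answersLinear F Q)) := by rw [h4]; ring
    _ ≤ _ := by gcongr

/-- The message indices in `[a, b)`. -/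
def indexRange (K a b : ℕ) : Finset (Fin K) := Finset.univ.filter fun i => a ≤ i.1 ∧ i.1 < b

lemma mem_indexRange {a b : ℕ} {i : Fin K} : i ∈ indexRange K a b ↔ a ≤ i.1 ∧ i.1 < b := by
  simp [indexRange]

lemma card_indexRange {a b : ℕ} (hb : b ≤ K) : (indexRange K a b).card = b - a := by
  rw [← Finset.card_map Fin.valEmbedding, ← Nat.card_Ico]
  congr 1
  ext x
  simp only [Finset.mem_map, mem_indexRange, Fin.valEmbedding_apply, Finset.mem_Ico]
  exact ⟨fun ⟨i, hi, he⟩ => he ▸ hi, fun hx => ⟨⟨x, hx.2.trans_le hb⟩, hx, rfl⟩⟩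

lemma demandMessages_eq_zero_iff (h : D ≤ K) (j : Fin (K - D + 1)) (X : Dataset F K L) :
    demandMessages h j X = 0 ↔ X ∈ vanishing F K L (indexRange K j (j + D)) := by
  rw [mem_vanishing]
  constructor
  · intro hX i hi
    rw [mem_indexRange] at hi
    have := congrFun hX ⟨i.1 - j.1, by omega⟩
    have he : demandIndex h j ⟨i.1 - j.1, by omega⟩ = i :=
      Fin.ext (by simp only [demandIndex]; omega)
    rwa [demandMessages, he] at this
  · intro hX
    funext d
    exact hX _ (mem_indexRange.2 ⟨by simp [demandIndex], by simp [demandIndex]⟩)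

namespace Scheme

/-- The total over the servers of the mean residual rank, under the law of the queries for demand
number `0`; for a private scheme every demand gives the same value. -/
noncomputable def meanRank (F : Type*) [Field F] (S : Scheme N K D L T) (s : Finset (Fin K)) : ℝ :=
  ∑ n, ∑ q, (S.queryMarginal n 0 q).toReal * residualRank F s q

lemma meanRank_nonneg (S : Scheme N K D L T) (s : Finset (Fin K)) : 0 ≤ S.meanRank F s :=
  Finset.sum_nonneg fun _ _ => Finset.sum_nonneg fun _ _ =>
    mul_nonneg ENNReal.toReal_nonneg (Nat.cast_nonneg _)

lemma meanRank_le (S : Scheme N K D L T) (s : Finset (Fin K)) :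
    S.meanRank F s ≤ (N : ℝ) * T := by
  have : ∀ n : Fin N, ∑ q, (S.queryMarginal n 0 q).toReal * (residualRank F s q : ℝ) ≤ T := by
    intro n
    calc _ ≤ ∑ q, (S.queryMarginal n 0 q).toReal * (T : ℝ) :=
          Finset.sum_le_sum fun q _ => mul_le_mul_of_nonneg_left
            (by exact_mod_cast residualRank_le s q) ENNReal.toReal_nonneg
      _ = T := by rw [← Finset.sum_mul, sum_toReal_eq_one, one_mul]
  refine (Finset.sum_le_sum fun n _ => this n).trans ?_
  simp

lemma meanRank_eq (S : Scheme N K D L T)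
    (hS : ∀ n j j', S.queryMarginal n j = S.queryMarginal n j') (s : Finset (Fin K))
    (j : Fin (K - D + 1)) :
    S.meanRank F s = ∑ Q, (S.queryLaw j Q).toReal * ∑ n, (residualRank F s (Q n) : ℝ) := by
  classical
  unfold meanRank
  simp only [Finset.mul_sum]
  rw [Finset.sum_comm (s := (Finset.univ : Finset (Fin N → Query K L T)))]
  refine Finset.sum_congr rfl fun n _ => ?_
  rw [hS n 0 j]
  simp only [queryMarginal, toReal_map_apply, Finset.sum_mul, ite_mul, zero_mul]
  rw [Finset.sum_comm]
  refine Finset.sum_congr rfl fun Q _ => ?_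
  simp

variable [Fintype F]

lemma meanRank_step (S : Scheme N K D L T) (h : D ≤ K) (hC : S.Correct F h)
    (hS : ∀ n j j', S.queryMarginal n j = S.queryMarginal n j') (s : Finset (Fin K))
    (j : Fin (K - D + 1)) :
    (N : ℝ) * (L * (indexRange K j (j + D) \ s).card) + S.meanRank F (s ∪ indexRange K j (j + D))
      ≤ N * S.meanRank F s := by
  set w := indexRange K j (j + D) with hw
  have hC' := (S.correct_iff h).1 hC j
  have hQ : ∀ Q, (S.queryLaw j Q).toReal * ((N : ℝ) * (L * (w \ s).card)
      + ∑ n, (residualRank F (s ∪ w) (Q n) : ℝ))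
      ≤ (S.queryLaw j Q).toReal * (N * ∑ n, (residualRank F s (Q n) : ℝ)) := by
    intro Q
    by_cases h0 : S.queryLaw j Q = 0
    · simp [h0]
    refine mul_le_mul_of_nonneg_left ?_ ENNReal.toReal_nonneg
    exact_mod_cast residualRank_step Q s w fun X hX =>
      (demandMessages_eq_zero_iff h j X).1 (hC' Q ((PMF.mem_support_iff _ _).2 h0) X hX)
  have := Finset.sum_le_sum fun Q (_ : Q ∈ Finset.univ) => hQ Q
  rw [S.meanRank_eq hS (s ∪ w) j, S.meanRank_eq hS s j, Finset.mul_sum]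
  calc _ = _ := ?_
    _ ≤ _ := this
    _ = _ := Finset.sum_congr rfl fun Q _ => by ring
  simp only [mul_add, Finset.sum_add_distrib, ← Finset.sum_mul, sum_toReal_eq_one, one_mul]

end Scheme

/-- The denominator of `optimalRate`. -/
noncomputable def rateDenominator (N K D : ℕ) : ℝ :=
  (D : ℝ) * N * ((N : ℝ) ^ (K / D) - 1) / ((N : ℝ) - 1) + K - (D : ℝ) * ((K / D : ℕ) : ℝ)

lemma rateDenominator_pos (hN : 2 ≤ N) (hD : 0 < D) (hDK : D ≤ K) : 0 < rateDenominator N K D := by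
  have hN' : (1 : ℝ) < N := by exact_mod_cast hN
  have h1 : (D : ℝ) * ((K / D : ℕ) : ℝ) ≤ K := by exact_mod_cast Nat.mul_div_le K D
  have h2 : (1 : ℝ) < (N : ℝ) ^ (K / D) := one_lt_pow₀ hN' (Nat.div_pos hDK hD).ne'
  have h3 : 0 < (D : ℝ) * N * ((N : ℝ) ^ (K / D) - 1) / ((N : ℝ) - 1) := by
    have : (0 : ℝ) < D := by exact_mod_cast hD
    have := sub_pos.2 hN'
    have := sub_pos.2 h2
    positivity
  unfold rateDenominator
  linarith

namespace Scheme

variable [Fintype F]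

/-- Demanding the disjoint windows `[mD, (m+1)D)` for `m < ⌊K / D⌋` one after the other, and at
last the window that ends at `K`, gives the lower bound on the total download. -/
lemma rateDenominator_mul_le (S : Scheme N K D L T) (hN : 2 ≤ N) (hD : 0 < D) (h : D ≤ K)
    (hC : S.Correct F h) (hS : ∀ n j j', S.queryMarginal n j = S.queryMarginal n j') :
    L * rateDenominator N K D ≤ (N : ℝ) ^ (K / D) * S.meanRank F ∅ := by
  set f := K / D with hf
  have hfK : f * D ≤ K := Nat.div_mul_le_self K D
  have hKf : K < (f + 1) * D := by
    rw [hf, ← Nat.div_lt_iff_lt_mul hD]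
    exact Nat.lt_succ_self _
  have hN' : (1 : ℝ) < N := by exact_mod_cast hN
  have hN0 : (0 : ℝ) < N := by linarith
  have key : ∀ k ≤ f, L * ((D : ℝ) * N * ((N : ℝ) ^ k - 1) / ((N : ℝ) - 1) + K - D * f)
      ≤ (N : ℝ) ^ k * S.meanRank F (indexRange K 0 ((f - k) * D)) := by
    intro k
    induction k with
    | zero =>
      intro _
      have hstep := S.meanRank_step h hC hS (indexRange K 0 (f * D)) ⟨K - D, by omega⟩
      have hset : indexRange K (K - D) (K - D + D) \ indexRange K 0 (f * D)
          = indexRange K (f * D) K := by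
        ext i
        have : (f + 1) * D = f * D + D := by ring
        simp only [Finset.mem_sdiff, mem_indexRange]
        omega
      simp only [hset, card_indexRange le_rfl] at hstep
      rw [Nat.cast_sub hfK] at hstep
      have h0 := S.meanRank_nonneg (F := F) (indexRange K 0 (f * D)
        ∪ indexRange K (K - D) (K - D + D))
      have h1 : (N : ℝ) * (L * (K - D * f)) ≤ N * S.meanRank F (indexRange K 0 (f * D)) := by
        push_cast at hstep
        linarith
      have := le_of_mul_le_mul_left h1 hN0
      simpa using this
    | succ k ih =>
      intro hk
      have ih := ih (by omega)
      set m := f - (k + 1) with hm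
      have hm1 : f - k = m + 1 := by omega
      have hmK : (m + 1) * D ≤ K :=
        (Nat.mul_le_mul_right D (by omega : m + 1 ≤ f)).trans hfK
      have hmD : (m + 1) * D = m * D + D := by ring
      rw [hm1] at ih
      have hstep := S.meanRank_step h hC hS (indexRange K 0 (m * D)) ⟨m * D, by omega⟩
      have hset1 : indexRange K (m * D) (m * D + D) \ indexRange K 0 (m * D)
          = indexRange K (m * D) (m * D + D) := by
        ext i
        simp only [Finset.mem_sdiff, mem_indexRange]
        omega
      have hset2 : indexRange K 0 (m * D) ∪ indexRange K (m * D) (m * D + D)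
          = indexRange K 0 ((m + 1) * D) := by
        ext i
        simp only [Finset.mem_union, mem_indexRange]
        omega
      simp only [hset1, hset2, card_indexRange (hmD ▸ hmK), Nat.add_sub_cancel_left] at hstep
      have hNk : (0 : ℝ) < (N : ℝ) ^ k := by positivity
      have hne : (N : ℝ) - 1 ≠ 0 := (sub_pos.2 hN').ne'
      calc _ = (N : ℝ) ^ k * (N * (L * D))
            + L * ((D : ℝ) * N * ((N : ℝ) ^ k - 1) / ((N : ℝ) - 1) + K - D * f) := by
              field_simp
              ring
        _ ≤ (N : ℝ) ^ k * (N * (L * D))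
            + (N : ℝ) ^ k * S.meanRank F (indexRange K 0 ((m + 1) * D)) := by gcongr
        _ = (N : ℝ) ^ k * (N * (L * D) + S.meanRank F (indexRange K 0 ((m + 1) * D))) := by ring
        _ ≤ (N : ℝ) ^ k * (N * S.meanRank F (indexRange K 0 (m * D))) := by gcongr
        _ = _ := by ring
  have := key f le_rfl
  have he : indexRange K 0 ((f - f) * D) = ∅ := by
    ext i
    simp [mem_indexRange]
  rwa [he] at this

lemma rate_eq (S : Scheme N K D L T) (h : D ≤ K) {p : PMF (Fin (K - D + 1))}
    (hp : ∀ j, p j ≠ 0) (hS : S.Private F p) :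
    S.rate F h p = (D : ℝ) * L / S.meanRank F ∅ := by
  unfold rate meanRank
  rw [S.entropy_demand]
  congr 1
  refine Finset.sum_congr rfl fun n _ => ?_
  rw [S.condEntropy_answer hp hS]
  simp only [residualRank_empty]

variable {p : PMF (Fin (K - D + 1))}

lemma meanRank_pos (S : Scheme N K D L T) (hN : 2 ≤ N) (hD : 0 < D) (h : D ≤ K) (hL : 1 ≤ L)
    (hp : ∀ j, p j ≠ 0) (hC : S.Correct F h) (hS : S.Private F p) : 0 < S.meanRank F ∅ := by
  have h1 := S.rateDenominator_mul_le hN hD h hC ((S.private_iff hp).1 hS)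
  have h2 : 0 < (L : ℝ) * rateDenominator N K D :=
    mul_pos (by exact_mod_cast hL) (rateDenominator_pos hN hD h)
  have hN0 : (0 : ℝ) ≤ (N : ℝ) ^ (K / D) := by positivity
  exact pos_of_mul_pos_right (h2.trans_le h1) hN0

lemma rate_le (S : Scheme N K D L T) (hN : 2 ≤ N) (hD : 0 < D) (h : D ≤ K) (hL : 1 ≤ L)
    (hp : ∀ j, p j ≠ 0) (hC : S.Correct F h) (hS : S.Private F p) :
    S.rate F h p ≤ optimalRate N K D := by
  have h1 := S.rateDenominator_mul_le hN hD h hC ((S.private_iff hp).1 hS)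
  rw [S.rate_eq h hp hS]
  change _ ≤ (D : ℝ) * (N : ℝ) ^ (K / D) / rateDenominator N K D
  rw [div_le_div_iff₀ (S.meanRank_pos hN hD h hL hp hC hS) (rateDenominator_pos hN hD h),
    mul_assoc, mul_assoc]
  exact mul_le_mul_of_nonneg_left h1 (Nat.cast_nonneg D)

/-- Each server sends at most `T` symbols' worth of entropy. -/
lemma symbolRate_le_rate (S : Scheme N K D L T) (hN : 2 ≤ N) (hD : 0 < D) (h : D ≤ K)
    (hL : 1 ≤ L) (hp : ∀ j, p j ≠ 0) (hC : S.Correct F h) (hS : S.Private F p) :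
    (D : ℝ) * L / (N * T) ≤ S.rate F h p := by
  rw [S.rate_eq h hp hS]
  exact div_le_div_of_nonneg_left (by positivity) (S.meanRank_pos hN hD h hL hp hC hS)
    (S.meanRank_le ∅)

end Scheme

end Converse

/-! ### A scheme that attains the bound -/

lemma uniformOfFintype_map_equiv {α : Type*} [Fintype α] [Nonempty α] (e : α ≃ α) :
    (PMF.uniformOfFintype α).map e = PMF.uniformOfFintype α := by
  classical
  refine PMF.ext fun a => ?_
  rw [PMF.map_apply, tsum_eq_single (e.symm a)]
  · simp
  · intro b hb
    rw [if_neg]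
    rintro rfl
    simp at hb

section Construction

/-- The positions inside a message: a segment, indexed by the vectors over `ZMod N` with one
coordinate per message, and a nonzero residue inside the segment. -/
abbrev Subpacket (N K : ℕ) : Type := (Fin K → ZMod N) × {x : ZMod N // x ≠ 0}

/-- The sums requested from a server: a residue class `c` modulo `D` of message indices, and a
vector `v` that is not zero on that class. The sum ranges over the messages `i` of the class and
takes the symbol `v i` of message `i`, where the symbol `0` is a dummy with value zero. -/
abbrev Request (N K D : ℕ) : Type :=
  {cv : Fin D × (Fin K → ZMod N) // ∃ i : Fin K, i.1 % D = cv.1.1 ∧ cv.2 i ≠ 0}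

variable {N K D : ℕ}

/-- The indicator vector of the demanded window. -/
def windowIndicator (N : ℕ) {K D : ℕ} (j : Fin (K - D + 1)) : Fin K → ZMod N :=
  fun i => if i ∈ indexRange K j (j + D) then 1 else 0

variable [NeZero N]

/-- Numbering of the positions inside a message. -/
noncomputable def subpacketEquiv (N K : ℕ) [NeZero N] :
    Fin (Fintype.card (Subpacket N K)) ≃ Subpacket N K :=
  (Fintype.equivFin _).symm

/-- Numbering of the requests. -/
noncomputable def requestEquiv (N K D : ℕ) [NeZero N] :
    Fin (Fintype.card (Request N K D)) ≃ Request N K D :=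
  (Fintype.equivFin _).symm

/-- The query with key `w`: the request `(c, v)` is served from the segment `v + w`. -/
noncomputable def keyQuery (D : ℕ) (w : Fin K → ZMod N) :
    Query K (Fintype.card (Subpacket N K)) (Fintype.card (Request N K D)) :=
  fun t i l => decide (i.1 % D = (requestEquiv N K D t).1.1.1 ∧
    (subpacketEquiv N K l).1 = (requestEquiv N K D t).1.2 + w ∧
    (subpacketEquiv N K l).2.1 = (requestEquiv N K D t).1.2 i)

/-- One uniform key `u`; server `n` sees only the shifted key `u - n • 1_W`, which is uniform
too. -/
noncomputable def residueScheme (N K D : ℕ) [NeZero N] :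
    Scheme N K D (Fintype.card (Subpacket N K)) (Fintype.card (Request N K D)) where
  queryLaw j := (PMF.uniformOfFintype (Fin K → ZMod N)).map fun u n =>
    keyQuery D (u - (n.1 : ZMod N) • windowIndicator N j)

lemma residueScheme_queryMarginal (n : Fin N) (j : Fin (K - D + 1)) :
    (residueScheme N K D).queryMarginal n j
      = (PMF.uniformOfFintype (Fin K → ZMod N)).map (keyQuery D) := by
  unfold Scheme.queryMarginal residueScheme
  rw [PMF.map_comp]
  conv_rhs =>
    rw [← uniformOfFintype_map_equiv (Equiv.subRight ((n.1 : ZMod N) • windowIndicator N j)),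
      PMF.map_comp]
  rfl

variable {F : Type*} [Field F]

/-- The symbol of message `i` in segment `s` at the residue `x`, with value zero for `x = 0`. -/
noncomputable def symbolAt (X : Dataset F K (Fintype.card (Subpacket N K))) (i : Fin K)
    (s : Fin K → ZMod N) (x : ZMod N) : F :=
  if h : x ≠ 0 then X i ((subpacketEquiv N K).symm (s, ⟨x, h⟩)) else 0

lemma symbolAt_zero (X : Dataset F K (Fintype.card (Subpacket N K))) (i : Fin K)
    (s : Fin K → ZMod N) : symbolAt X i s 0 = 0 := by
  simp [symbolAt]

lemma answer_keyQuery (w : Fin K → ZMod N) (X : Dataset F K (Fintype.card (Subpacket N K)))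
    (r : Request N K D) :
    answer (keyQuery D w) X ((requestEquiv N K D).symm r)
      = ∑ i with i.1 % D = r.1.1.1, symbolAt X i (r.1.2 + w) (r.1.2 i) := by
  unfold answer keyQuery
  rw [Finset.sum_filter]
  refine Finset.sum_congr rfl fun i _ => ?_
  rw [← (subpacketEquiv N K).symm.sum_comp]
  simp only [Equiv.apply_symm_apply, decide_eq_true_eq, ite_mul, one_mul, zero_mul]
  by_cases hi : i.1 % D = r.1.1.1
  · simp only [hi, true_and, if_true, symbolAt]
    by_cases hx : r.1.2 i ≠ 0
    · rw [dif_pos hx, Finset.sum_eq_single (r.1.2 + w, ⟨r.1.2 i, hx⟩)]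
      · simp
      · rintro ⟨s, x⟩ _ hne
        rw [if_neg]
        rintro he
        exact hne (Prod.ext he.1 (Subtype.ext he.2))
      · simp
    · rw [dif_neg hx]
      refine Finset.sum_eq_zero fun y _ => if_neg ?_
      rintro he
      exact hx (he.2 ▸ y.2.2)
  · simp [hi]

/-- If the answer to a key vanishes, all sums vanish, also those over vectors `v` that are zero on
the class and hence not requested. -/
lemma sum_symbolAt_eq_zero {w : Fin K → ZMod N} {X : Dataset F K (Fintype.card (Subpacket N K))}
    (h : answer (keyQuery D w) X = 0) (c : Fin D) (v : Fin K → ZMod N) :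
    ∑ i with i.1 % D = c.1, symbolAt X i (v + w) (v i) = 0 := by
  by_cases hr : ∃ i : Fin K, i.1 % D = c.1 ∧ v i ≠ 0
  · rw [← answer_keyQuery w X ⟨(c, v), hr⟩, h, Pi.zero_apply]
  · push Not at hr
    refine Finset.sum_eq_zero fun i hi => ?_
    rw [hr i (Finset.mem_filter.1 hi).2, symbolAt_zero]

lemma residueScheme_correct [Fintype F] (hD : 0 < D) (h : D ≤ K) :
    (residueScheme N K D).Correct F h := by
  classical
  rw [Scheme.correct_iff]
  intro j Q hQ X hX
  obtain ⟨u, -, rfl⟩ := (PMF.mem_support_map_iff _ _ _).1 hQ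
  rw [demandMessages_eq_zero_iff, mem_vanishing]
  intro i₀ hi₀
  set W := indexRange K j (j + D) with hW
  -- `W` is an interval of length `D`, so it contains a single member of the class of `i₀`
  have huniq : ∀ i : Fin K, i.1 % D = i₀.1 % D → i ∈ W → i = i₀ := by
    intro i hi hiW
    rw [hW, mem_indexRange] at hiW hi₀
    have hmod : i.1 ≡ i₀.1 [MOD D] := hi
    apply Fin.ext
    rcases le_total i.1 i₀.1 with hle | hle
    · exact hmod.eq_of_abs_lt (by rw [abs_lt]; omega)
    · exact hmod.eq_of_abs_lt (by rw [abs_lt]; omega)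
  -- in segment `s` the servers add to one and the same interference all symbols of message `i₀`
  have hsum : ∀ (s : Fin K → ZMod N) (x : ZMod N),
      symbolAt X i₀ s x
        + ∑ i with i.1 % D = i₀.1 % D ∧ i ≠ i₀, symbolAt X i s ((s - u) i) = 0 := by
    intro s x
    set n : ZMod N := x - (s - u) i₀ with hn
    have hans : answer (keyQuery D (u - n • windowIndicator N j)) X = 0 := by
      have := congrFun hX ⟨n.val, n.val_lt⟩
      simpa [answersLinear] using this
    have h0 := sum_symbolAt_eq_zero hans ⟨i₀.1 % D, Nat.mod_lt _ hD⟩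
      (s - (u - n • windowIndicator N j))
    simp only [sub_add_cancel] at h0
    rw [← Finset.add_sum_erase _ _ (a := i₀) (by simp)] at h0
    convert h0 using 2
    · congr 1
      have hone : windowIndicator N j i₀ = 1 := if_pos hi₀
      simp only [Pi.sub_apply, Pi.smul_apply, smul_eq_mul, hone, hn]
      ring
    · refine Finset.sum_congr ?_ fun i hi => ?_
      · ext i
        simp [and_comm]
      · have hi : i.1 % D = i₀.1 % D ∧ i ≠ i₀ := by simpa [and_comm] using hi
        have hiW : i ∉ W := fun hiW => hi.2 (huniq i hi.1 hiW)
        have hzero : windowIndicator N j i = 0 := if_neg hiW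
        simp [hzero]
  have hzero : ∀ s x, symbolAt X i₀ s x = 0 := by
    intro s x
    have h1 := hsum s x
    have h2 := hsum s 0
    rw [symbolAt_zero, zero_add] at h2
    rwa [h2, add_zero] at h1
  funext l
  have := hzero (subpacketEquiv N K l).1 (subpacketEquiv N K l).2
  rw [symbolAt, dif_pos (subpacketEquiv N K l).2.2] at this
  simpa using this

end Construction

/-! ### The rate of the scheme -/

section Counting

variable {N K D : ℕ}

lemma card_residueClass (hD : 0 < D) (c : Fin D) :
    (Finset.univ.filter fun i : Fin K => i.1 % D = c.1).card
      = K / D + if c.1 < K % D then 1 else 0 := by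
  have h := Nat.count_modEq_card K hD c.1
  rw [Nat.mod_eq_of_lt c.2] at h
  rw [← h, Nat.count_eq_card_filter_range, ← Finset.card_map Fin.valEmbedding]
  congr 1
  ext x
  simp only [Finset.mem_map, Finset.mem_filter, Finset.mem_univ, true_and, Fin.valEmbedding_apply,
    Finset.mem_range, Nat.ModEq, Nat.mod_eq_of_lt c.2]
  exact ⟨fun ⟨i, hi, he⟩ => he ▸ ⟨i.2, hi⟩, fun hx => ⟨⟨x, hx.1⟩, hx.2, rfl⟩⟩

variable [NeZero N]

lemma card_zero_on_mul (s : Finset (Fin K)) :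
    (Finset.univ.filter fun v : Fin K → ZMod N => ∀ i ∈ s, v i = 0).card * N ^ s.card
      = N ^ K := by
  classical
  have h : (Finset.univ.filter fun v : Fin K → ZMod N => ∀ i ∈ s, v i = 0)
      = Fintype.piFinset fun i => if i ∈ s then {0} else Finset.univ := by
    ext v
    simp only [Finset.mem_filter, Finset.mem_univ, true_and, Fintype.mem_piFinset]
    refine forall_congr' fun i => ?_
    by_cases hi : i ∈ s <;> simp [hi]
  rw [h, Fintype.card_piFinset]
  simp only [apply_ite Finset.card, Finset.card_singleton, Finset.card_univ, ZMod.card]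
  rw [Finset.prod_ite]
  simp only [Finset.prod_const_one, one_mul, Finset.prod_const]
  rw [← pow_add]
  congr 1
  have h2 : (Finset.univ.filter fun i => i ∉ s) = sᶜ := by ext; simp
  rw [h2, Finset.card_compl, Fintype.card_fin]
  have := s.card_le_univ
  rw [Fintype.card_fin] at this
  omega

lemma card_subpacket : (Fintype.card (Subpacket N K) : ℝ) = (N : ℝ) ^ K * (N - 1) := by
  have h1 : Fintype.card {x : ZMod N // x ≠ 0} = N - 1 := by
    rw [Fintype.card_subtype_compl, ZMod.card, Fintype.card_subtype_eq]
  have h2 : 1 ≤ N := NeZero.one_le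
  simp [Fintype.card_prod, h1, Nat.cast_sub h2]

lemma card_request (hD : 0 < D) :
    (N : ℝ) ^ (K / D + 1) * (Fintype.card (Request N K D) : ℝ)
      = (N : ℝ) ^ K * ((D : ℝ) * N ^ (K / D + 1) - N * D + (K % D : ℕ) * (N - 1)) := by
  classical
  have hN0 : (N : ℝ) ≠ 0 := by exact_mod_cast NeZero.ne N
  have hcard : Fintype.card (Request N K D) = ∑ c : Fin D, (Finset.univ.filter
      fun v : Fin K → ZMod N => ¬ ∀ i ∈ Finset.univ.filter (fun i : Fin K => i.1 % D = c.1),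
        v i = 0).card := by
    rw [Fintype.card_subtype, ← Finset.card_sigma]
    refine Finset.card_bij (fun cv _ => ⟨cv.1, cv.2⟩) ?_ ?_ ?_
    · rintro ⟨c, v⟩ h
      simpa using h
    · rintro ⟨c, v⟩ _ ⟨c', v'⟩ _ h
      simpa using h
    · rintro ⟨c, v⟩ h
      exact ⟨(c, v), by simpa using h, rfl⟩
  have hclass : ∀ c : Fin D, (N : ℝ) ^ (K / D + 1) * ((Finset.univ.filter
      fun v : Fin K → ZMod N => ¬ ∀ i ∈ Finset.univ.filter (fun i : Fin K => i.1 % D = c.1),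
        v i = 0).card : ℝ)
      = (N : ℝ) ^ K * (N ^ (K / D + 1) - N + if c.1 < K % D then (N - 1 : ℝ) else 0) := by
    intro c
    set s := Finset.univ.filter (fun i : Fin K => i.1 % D = c.1) with hs
    have h1 := card_zero_on_mul (N := N) s
    have h2 := Finset.card_filter_add_card_filter_not (s := (Finset.univ : Finset (Fin K → ZMod N)))
      (fun v => ∀ i ∈ s, v i = 0)
    rw [Finset.card_univ, Fintype.card_pi_const, ZMod.card] at h2
    rw [hs, card_residueClass hD c, ← hs] at h1
    generalize (Finset.univ.filter fun v : Fin K → ZMod N => ∀ i ∈ s, v i = 0).card = a at h1 h2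
    generalize (Finset.univ.filter fun v : Fin K → ZMod N => ¬ ∀ i ∈ s, v i = 0).card = b at h2 ⊢
    have h1' := congrArg (Nat.cast : ℕ → ℝ) h1
    have h2' := congrArg (Nat.cast : ℕ → ℝ) h2
    push_cast at h1' h2'
    split_ifs at h1' ⊢ with hc
    · linear_combination (N : ℝ) ^ (K / D + 1) * h2' - h1'
    · rw [add_zero] at h1'
      rw [pow_succ]
      linear_combination (N : ℝ) ^ (K / D) * N * h2' - (N : ℝ) * h1'
  rw [hcard, Nat.cast_sum, Finset.mul_sum, Finset.sum_congr rfl fun c _ => hclass c,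
    ← Finset.mul_sum, Finset.sum_add_distrib, Finset.sum_const, ← Finset.sum_filter,
    Finset.sum_const]
  have hr : (Finset.univ.filter fun c : Fin D => c.1 < K % D).card = K % D := by
    have := card_indexRange (K := D) (a := 0) (Nat.mod_lt K hD).le
    simpa [indexRange] using this
  rw [hr, Finset.card_univ, Fintype.card_fin, nsmul_eq_mul, nsmul_eq_mul]
  ring

/-- The symbol rate of `residueScheme`. -/
lemma symbolRate_residueScheme (hN : 2 ≤ N) (hD : 0 < D) (h : D ≤ K) :
    optimalRate N K D = (D : ℝ) * (Fintype.card (Subpacket N K) : ℝ)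
      / (N * (Fintype.card (Request N K D) : ℝ)) := by
  have hN1 : (N : ℝ) - 1 ≠ 0 := by
    have : (1 : ℝ) < N := by exact_mod_cast hN
    linarith
  have hN0 : (0 : ℝ) < N := by positivity
  have hden := rateDenominator_pos hN hD h
  have hmod : ((K % D : ℕ) : ℝ) = K - D * (K / D : ℕ) := by
    have := Nat.mod_add_div K D
    rw [eq_sub_iff_add_eq]
    exact_mod_cast this
  have hkey : (Fintype.card (Subpacket N K) : ℝ) * rateDenominator N K D
      = (N : ℝ) ^ (K / D + 1) * (Fintype.card (Request N K D) : ℝ) := by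
    rw [card_request hD, card_subpacket, hmod, rateDenominator]
    field_simp
    ring
  have hT : (0 : ℝ) < (Fintype.card (Request N K D) : ℝ) := by
    have hL : (0 : ℝ) < (Fintype.card (Subpacket N K) : ℝ) := by
      rw [card_subpacket]
      have : (1 : ℝ) < N := by exact_mod_cast hN
      have := sub_pos.2 this
      positivity
    exact pos_of_mul_pos_right ((mul_pos hL hden).trans_eq hkey) (by positivity)
  change (D : ℝ) * (N : ℝ) ^ (K / D) / rateDenominator N K D = _
  rw [div_eq_div_iff hden.ne' (mul_pos hN0 hT).ne']
  linear_combination -(D : ℝ) * hkey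

end Counting

end PCBR

theorem theorem1 {F : Type*} [Field F] [Fintype F] (N K D : ℕ)
    (hN : 2 ≤ N) (hD : 2 ≤ D) (hDK : D < K)
    (p : PMF (Fin (K - D + 1))) (hp : ∀ j, p j ≠ 0) :
    IsGreatest (PCBR.achievableRates F N hDK.le p) (PCBR.optimalRate N K D) ∧
      IsGreatest (PCBR.achievableSymbolRates F N hDK.le p) (PCBR.optimalRate N K D) := by
  have : NeZero N := ⟨by omega⟩
  have : Fact (1 < N) := ⟨hN⟩
  have hD0 : 0 < D := by omega
  have hC := PCBR.residueScheme_correct (N := N) (F := F) hD0 hDK.le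
  have hP : (PCBR.residueScheme N K D).Private F p :=
    (PCBR.Scheme.private_iff _ hp).2 fun n j j' => by
      rw [PCBR.residueScheme_queryMarginal, PCBR.residueScheme_queryMarginal]
  have hL : 1 ≤ Fintype.card (PCBR.Subpacket N K) :=
    Fintype.card_pos_iff.2 ⟨(0, ⟨1, one_ne_zero⟩)⟩
  have hR := PCBR.symbolRate_residueScheme (K := K) hN hD0 hDK.le
  refine ⟨⟨⟨_, _, hL, PCBR.residueScheme N K D, hC, hP, le_antisymm ?_ ?_⟩, ?_⟩,
    ⟨⟨_, _, hL, PCBR.residueScheme N K D, hC, hP, hR⟩, ?_⟩⟩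
  · rw [hR]
    exact PCBR.Scheme.symbolRate_le_rate _ hN hD0 hDK.le hL hp hC hP
  · exact PCBR.Scheme.rate_le _ hN hD0 hDK.le hL hp hC hP
  · rintro r ⟨L, T, hL, S, hC, hP, rfl⟩
    exact S.rate_le hN hD0 hDK.le hL hp hC hP
  · rintro r ⟨L, T, hL, S, hC, hP, rfl⟩
    exact (S.symbolRate_le_rate hN hD0 hDK.le hL hp hC hP).trans
      (S.rate_le hN hD0 hDK.le hL hp hC hP)
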